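/- For a finite connected graph $G$ and $X\subseteq V(G)$, two vertices $u,v$ are called $X$-visible if there is a shortest $u,v$-path $P$ in $G$ with $V(P)\cap X\subseteq\{u,v\}$. The set $X$ is an outer mutual-visibility set of $G$ if every two vertices $u,v\in X$ are $X$-visible and every $u\in X$, $v\in V(G)\setminus X$ are $X$-visible; the outer mutual-visibility number $\mu_{\rm o}(G)$ is the cardinality of a largest outer mutual-visibility set of $G$. Let $P_n\,\square\,P_m$ denote the grid graph, that is, the Cartesian product of the paths on $n$ and on $m$ vertices. Theorem. If $n\ge m\ge 2$, then $$\mu_{\rm o}(P_n\,\square\, P_m) = \begin{cases} 2; & (n,m)=(2,2),\\ 4; & (n,m) \in \{(3,2), (3,3), (4,3), (4,4)\}, \\ 5; & (n,m) \in \{(5,4), (5,5), (6,4)\}, \\ 6; & (n,m)=(6,5), \\ m+2; & \text{otherwise}. \end{cases}$$ -/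

import Mathlib

namespace SimpleGraph

/-- Vertices `u` and `v` are `X`-visible if there is a shortest `u,v`-path whose vertices
in `X` are among `u` and `v`. -/
def XVisible {V : Type*} (G : SimpleGraph V) (X : Set V) (u v : V) : Prop :=
  ∃ p : G.Walk u v, p.IsPath ∧ p.length = G.dist u v ∧
    ∀ w ∈ p.support, w ∈ X → w = u ∨ w = v

/-- `X` is an outer mutual-visibility set: any two vertices of `X` are `X`-visible, and any
vertex of `X` and any vertex outside `X` are `X`-visible. -/
def IsOuterMutualVisibilitySet {V : Type*} (G : SimpleGraph V) (X : Set V) : Prop :=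
  (∀ u ∈ X, ∀ v ∈ X, G.XVisible X u v) ∧ (∀ u ∈ X, ∀ v ∈ Xᶜ, G.XVisible X u v)

/-- The outer mutual-visibility number of a finite graph: the cardinality of a largest outer
mutual-visibility set. The set of cardinalities is bounded (the graph is finite) and nonempty
(the empty set qualifies), so the supremum is attained. -/
noncomputable def outerMutualVisibilityNumber {V : Type*} [Finite V] (G : SimpleGraph V) : ℕ :=
  sSup {k : ℕ | ∃ X : Set V, G.IsOuterMutualVisibilitySet X ∧ X.ncard = k}

/-- The grid graph: the Cartesian product of the paths on `n` and on `m` vertices. -/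
def gridGraph (n m : ℕ) : SimpleGraph (Fin n × Fin m) :=
  pathGraph n □ pathGraph m

end SimpleGraph

/-!
A vertex of a path has a single predecessor on the way from any other vertex, so a vertex of the
grid has at most two predecessors on the shortest paths from a given vertex. Hence a set is an outer
mutual-visibility set exactly when its points on a common line are the two ends of that line and no
point of it sees two others as the two predecessors of a third vertex.

If the set has more points than there are rows, some row contains both its ends, and these two
points rule out all diagonal adjacencies within the set. Off the last column each row contains at
most one point, and the last column contains at most two, which gives the bound `m + 2`. Equality
forces the four corners and one point in each inner row, that is, a sequence of distinct columns in
which consecutive entries are not adjacent. Such sequences exist except in the smallest grids; there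
one leaves out a few rows, and in the `2 × 2`, `4 × 4` and `5 × 5` grids even `m + 1` points are
impossible.
-/

namespace OuterMutualVisibility

open SimpleGraph

section Predecessor

variable {V W : Type*} {G : SimpleGraph V} {H : SimpleGraph W} {u v w : V}

/-- `w` is the vertex before `v` on some shortest path from `u` to `v`. -/
def IsPredecessor (G : SimpleGraph V) (u w v : V) : Prop :=
  G.Adj w v ∧ G.dist u w + 1 = G.dist u v

theorem IsPredecessor.ne_source (h : IsPredecessor G u w v) : v ≠ u := by
  rintro rfl
  simpa using h.2

theorem isPredecessor_penultimate {p : G.Walk u v} (hp : p.length = G.dist u v) (hne : u ≠ v) :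
    IsPredecessor G u p.penultimate v := by
  have hnil : ¬ p.Nil := Walk.not_nil_of_ne hne
  have hadj := p.adj_penultimate hnil
  have hle : G.dist u p.penultimate ≤ p.dropLast.length := dist_le _
  have hge : G.dist u v ≤ G.dist u p.penultimate + G.dist p.penultimate v :=
    Reachable.dist_triangle_left ⟨p.dropLast⟩ v
  rw [dist_eq_one_iff_adj.2 hadj] at hge
  have hlen : p.dropLast.length + 1 = p.length := Walk.length_dropLast_add_one hnil
  exact ⟨hadj, by omega⟩

theorem exists_isPredecessor (hG : G.Connected) (hne : u ≠ v) : ∃ w, IsPredecessor G u w v := by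
  obtain ⟨p, hp⟩ := hG.exists_walk_length_eq_dist u v
  exact ⟨_, isPredecessor_penultimate hp hne⟩

theorem exists_isPredecessor_of_xVisible {X : Set V} (h : G.XVisible X u v) (hne : u ≠ v) :
    ∃ w, IsPredecessor G u w v ∧ (w ∈ X → w = u) := by
  obtain ⟨p, -, hlen, hX⟩ := h
  have hpred := isPredecessor_penultimate hlen hne
  exact ⟨_, hpred, fun hw => (hX _ (p.getVert_mem_support _) hw).resolve_right hpred.1.ne⟩

theorem xVisible_of_forall_exists_isPredecessor {X : Set V}
    (h : ∀ v, v ≠ u → ∃ w, IsPredecessor G u w v ∧ (w ∈ X → w = u)) (v : V) :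
    G.XVisible X u v := by
  induction hd : G.dist u v generalizing v with
  | zero =>
    obtain rfl | hne := eq_or_ne v u
    · exact ⟨Walk.nil, by simp⟩
    · obtain ⟨w, hw, -⟩ := h v hne
      have := hw.2
      omega
  | succ d ih =>
    have hne : v ≠ u := by
      rintro rfl
      simp at hd
    obtain ⟨w, ⟨hadj, hdist⟩, hwX⟩ := h v hne
    obtain ⟨p, -, hlen, hpX⟩ := ih w (by omega)
    have hlen' : (p.concat hadj).length = G.dist u v := by rw [Walk.length_concat]; omega
    refine ⟨p.concat hadj, Walk.isPath_of_length_eq_dist _ hlen', hlen', fun x hx hxX => ?_⟩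
    rw [Walk.support_concat, List.mem_append, List.mem_singleton] at hx
    rcases hx with hx | rfl
    · exact Or.inl ((hpX x hx hxX).elim id fun hxw => hxw ▸ hwX (hxw ▸ hxX))
    · exact Or.inr rfl

theorem isOuterMutualVisibilitySet_iff_forall_exists_isPredecessor {X : Set V} :
    G.IsOuterMutualVisibilitySet X ↔
      ∀ u ∈ X, ∀ v, v ≠ u → ∃ w, IsPredecessor G u w v ∧ (w ∈ X → w = u) := by
  constructor
  · rintro ⟨hin, hout⟩ u hu v hne
    by_cases hv : v ∈ X
    · exact exists_isPredecessor_of_xVisible (hin u hu v hv) hne.symm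
    · exact exists_isPredecessor_of_xVisible (hout u hu v hv) hne.symm
  · intro h
    exact ⟨fun u hu v _ => xVisible_of_forall_exists_isPredecessor (h u hu) v,
      fun u hu v _ => xVisible_of_forall_exists_isPredecessor (h u hu) v⟩

theorem dist_boxProd (hG : G.Connected) (hH : H.Connected) (u v : V × W) :
    (G □ H).dist u v = G.dist u.1 v.1 + H.dist u.2 v.2 := by
  simp only [SimpleGraph.dist, edist_boxProd]
  exact ENat.toNat_add (edist_ne_top_iff_reachable.2 (hG _ _))
    (edist_ne_top_iff_reachable.2 (hH _ _))

theorem isPredecessor_boxProd_iff (hG : G.Connected) (hH : H.Connected) {u w v : V × W} :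
    IsPredecessor (G □ H) u w v ↔
      IsPredecessor G u.1 w.1 v.1 ∧ w.2 = v.2 ∨ w.1 = v.1 ∧ IsPredecessor H u.2 w.2 v.2 := by
  simp only [IsPredecessor, dist_boxProd hG hH, boxProd_adj]
  grind

/-- A geodetic graph: any two vertices are joined by at most one shortest path. This is encoded by
the uniqueness of the last step of shortest paths. -/
def IsGeodetic (G : SimpleGraph V) : Prop :=
  ∀ ⦃u v w w' : V⦄, IsPredecessor G u w v → IsPredecessor G u w' v → w = w'

-- Seen from `u`, a vertex on the line of `u` has a single predecessor, and the vertex `(q.1, p.2)`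
-- has at most the two predecessors `p` and `q` of the third condition.
theorem isOuterMutualVisibilitySet_boxProd_iff (hG : G.Connected) (hH : H.Connected)
    (hG' : IsGeodetic G) (hH' : IsGeodetic H) {X : Set (V × W)} :
    (G □ H).IsOuterMutualVisibilitySet X ↔
      (∀ u ∈ X, ∀ p ∈ X, u.2 = p.2 → u ≠ p → ∀ x, ¬ IsPredecessor G u.1 p.1 x) ∧
      (∀ u ∈ X, ∀ p ∈ X, u.1 = p.1 → u ≠ p → ∀ y, ¬ IsPredecessor H u.2 p.2 y) ∧
      ∀ u ∈ X, ∀ p ∈ X, ∀ q ∈ X,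
        IsPredecessor G u.1 p.1 q.1 → ¬ IsPredecessor H u.2 q.2 p.2 := by
  simp only [isOuterMutualVisibilitySet_iff_forall_exists_isPredecessor,
    isPredecessor_boxProd_iff hG hH]
  constructor
  · refine fun h => ⟨fun u hu p hp hup hne x hx => ?_, fun u hu p hp hup hne y hy => ?_,
      fun u hu p hp q hq hx hy => ?_⟩
    · obtain ⟨w, ⟨hw, hw'⟩ | ⟨-, hw⟩, hwX⟩ := h u hu (x, p.2) fun h => hx.ne_source (h ▸ rfl)
      · obtain rfl : w = p := Prod.ext (hG' hw hx) hw'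
        exact hne (hwX hp).symm
      · exact hw.ne_source hup.symm
    · obtain ⟨w, ⟨hw, -⟩ | ⟨hw', hw⟩, hwX⟩ := h u hu (p.1, y) fun h => hy.ne_source (h ▸ rfl)
      · exact hw.ne_source hup.symm
      · obtain rfl : w = p := Prod.ext hw' (hH' hw hy)
        exact hne (hwX hp).symm
    · obtain ⟨w, ⟨hw, hw'⟩ | ⟨hw', hw⟩, hwX⟩ := h u hu (q.1, p.2) fun h => hx.ne_source (h ▸ rfl)
      · obtain rfl : w = p := Prod.ext (hG' hw hx) hw'
        exact hy.ne_source (congrArg Prod.snd (hwX hp))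
      · obtain rfl : w = q := Prod.ext hw' (hH' hw hy)
        exact hx.ne_source (congrArg Prod.fst (hwX hq))
  · rintro ⟨hrow, hcol, hcorner⟩ u hu v hne
    by_cases h₂ : u.2 = v.2
    · obtain ⟨a, ha⟩ := exists_isPredecessor hG fun h₁ => hne (Prod.ext h₁ h₂).symm
      refine ⟨(a, v.2), Or.inl ⟨ha, rfl⟩, fun hw => ?_⟩
      by_contra hwu
      exact hrow u hu _ hw h₂ (Ne.symm hwu) _ ha
    · obtain ⟨b, hb⟩ := exists_isPredecessor hH h₂
      by_cases hq : (v.1, b) ∈ X → (v.1, b) = u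
      · exact ⟨(v.1, b), Or.inr ⟨rfl, hb⟩, hq⟩
      · push Not at hq
        obtain ⟨a, ha⟩ := exists_isPredecessor hG fun h₁ => hcol u hu _ hq.1 h₁ hq.2.symm _ hb
        exact ⟨(a, v.2), Or.inl ⟨ha, rfl⟩, fun hp => (hcorner u hu _ hp _ hq.1 ha hb).elim⟩

end Predecessor

section Number

variable {V : Type*} [Finite V] {G : SimpleGraph V}

theorem ncard_le_outerMutualVisibilityNumber {X : Set V} (hX : G.IsOuterMutualVisibilitySet X) :
    X.ncard ≤ G.outerMutualVisibilityNumber := by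
  refine le_csSup ⟨Nat.card V, ?_⟩ ⟨X, hX, rfl⟩
  rintro _ ⟨Y, -, rfl⟩
  exact Set.ncard_le_card Y

theorem exists_ncard_eq_outerMutualVisibilityNumber (G : SimpleGraph V) :
    ∃ X, G.IsOuterMutualVisibilitySet X ∧ X.ncard = G.outerMutualVisibilityNumber := by
  refine Nat.sSup_mem (s := {k | ∃ X, G.IsOuterMutualVisibilitySet X ∧ X.ncard = k})
    ⟨0, ∅, by simp [IsOuterMutualVisibilitySet]⟩ ⟨Nat.card V, ?_⟩
  rintro _ ⟨X, -, rfl⟩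
  exact Set.ncard_le_card X

end Number

section Path

variable {n : ℕ}

theorem connected_pathGraph [NeZero n] : (pathGraph n).Connected :=
  ⟨pathGraph_preconnected n⟩

theorem sub_le_length_of_pathGraph {a b : Fin n} (p : (pathGraph n).Walk a b) :
    (b : ℕ) - a ≤ p.length := by
  induction p with
  | nil => simp
  | cons hadj p ih =>
    rw [pathGraph_adj] at hadj
    rw [Walk.length_cons]
    omega

theorem dist_pathGraph_of_le {a b : Fin n} (hab : a ≤ b) : (pathGraph n).dist a b = b - a := by
  apply le_antisymm
  · induction hd : (b : ℕ) - a generalizing a with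
    | zero => simp [show a = b by omega]
    | succ d ih =>
      let c : Fin n := ⟨a + 1, by omega⟩
      have hac : (pathGraph n).Adj a c := pathGraph_adj.2 (Or.inl rfl)
      have hcb : (c : ℕ) = a + 1 := rfl
      have htri := hac.reachable.dist_triangle_left b
      rw [dist_eq_one_iff_adj.2 hac] at htri
      have := ih (a := c) (by omega) (by omega)
      omega
  · obtain ⟨p, hp⟩ := (pathGraph_preconnected n a b).exists_walk_length_eq_dist
    exact hp ▸ sub_le_length_of_pathGraph p

theorem dist_pathGraph (a b : Fin n) : (pathGraph n).dist a b = Nat.dist a b := by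
  obtain hab | hba := le_total a b
  · rw [dist_pathGraph_of_le hab, Nat.dist_eq_sub_of_le hab]
  · rw [dist_comm, dist_pathGraph_of_le hba, Nat.dist_eq_sub_of_le_right hba]

/-- `w` comes immediately before `v` on the way from `u` to `v` along the natural numbers: this is
`IsPredecessor` for paths. -/
def Precedes (u w v : ℕ) : Prop :=
  w + 1 = v ∧ u ≤ w ∨ v + 1 = w ∧ w ≤ u

theorem isPredecessor_pathGraph_iff {u w v : Fin n} :
    IsPredecessor (pathGraph n) u w v ↔ Precedes u w v := by
  rw [IsPredecessor, pathGraph_adj, dist_pathGraph, dist_pathGraph, Precedes, Nat.dist, Nat.dist]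
  omega

theorem isGeodetic_pathGraph : IsGeodetic (pathGraph n) := by
  intro u v w w' hw hw'
  rw [isPredecessor_pathGraph_iff, Precedes] at hw hw'
  omega

theorem forall_not_isPredecessor_pathGraph_iff {u w : Fin n} (hne : u ≠ w) :
    (∀ v, ¬ IsPredecessor (pathGraph n) u w v) ↔
      (u : ℕ) < w ∧ w + 1 = n ∨ (w : ℕ) < u ∧ (w : ℕ) = 0 := by
  simp only [isPredecessor_pathGraph_iff, Fin.forall_iff, Precedes]
  constructor
  · intro h
    have := h (w - 1) (by omega)
    have := h (w + 1)
    omega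
  · intro h v hv
    omega

end Path

section Grid

/-- The coordinates of the points of a set in the `n × m` grid such that the points of the set on a
common line are the two ends of that line. -/
structure MeetsLinesInEnds (n m : ℕ) (Y : Finset (ℕ × ℕ)) : Prop where
  lt : ∀ ⦃x y⦄, (x, y) ∈ Y → x < n ∧ y < m
  row : ∀ ⦃x x' y⦄, (x, y) ∈ Y → (x', y) ∈ Y → x < x' → x = 0 ∧ x' + 1 = n
  col : ∀ ⦃x y y'⦄, (x, y) ∈ Y → (x, y') ∈ Y → y < y' → y = 0 ∧ y' + 1 = m

/-- The coordinate form of outer mutual-visibility sets of the `n × m` grid. In `corner`, the points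
`(a, b)` and `(c, d)` are the two predecessors of `(c, b)` seen from `(s, t)`. -/
structure IsUnobstructed (n m : ℕ) (Y : Finset (ℕ × ℕ)) : Prop extends MeetsLinesInEnds n m Y where
  corner : ∀ ⦃s t a b c d⦄, (s, t) ∈ Y → (a, b) ∈ Y → (c, d) ∈ Y →
    Precedes s a c → ¬ Precedes t d b

/-- The natural-number coordinates of a vertex of the grid. -/
def coordinates (n m : ℕ) : Fin n × Fin m ↪ ℕ × ℕ :=
  Fin.valEmbedding.prodMap Fin.valEmbedding

theorem mk_mem_map_coordinates {n m x y : ℕ} {X : Finset (Fin n × Fin m)} :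
    (x, y) ∈ X.map (coordinates n m) ↔ ∃ (hx : x < n) (hy : y < m), (⟨x, hx⟩, ⟨y, hy⟩) ∈ X := by
  constructor
  · rw [Finset.mem_map]
    rintro ⟨⟨i, j⟩, hij, h⟩
    obtain ⟨rfl, rfl⟩ := Prod.ext_iff.1 h
    exact ⟨i.2, j.2, hij⟩
  · rintro ⟨hx, hy, h⟩
    exact Finset.mem_map_of_mem (coordinates n m) h

variable {n m : ℕ} [NeZero n] [NeZero m]

theorem isOuterMutualVisibilitySet_gridGraph_iff {X : Finset (Fin n × Fin m)} :
    (gridGraph n m).IsOuterMutualVisibilitySet X ↔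
      IsUnobstructed n m (X.map (coordinates n m)) := by
  rw [gridGraph, isOuterMutualVisibilitySet_boxProd_iff connected_pathGraph connected_pathGraph
    isGeodetic_pathGraph isGeodetic_pathGraph]
  constructor
  · rintro ⟨hrow, hcol, hcorner⟩
    refine ⟨⟨?_, ?_, ?_⟩, ?_⟩ <;> simp only [mk_mem_map_coordinates]
    · rintro x y ⟨hx, hy, -⟩
      exact ⟨hx, hy⟩
    · rintro x x' y ⟨hx, hy, h⟩ ⟨hx', _, h'⟩ hlt
      have hne : (⟨x, hx⟩ : Fin n) ≠ ⟨x', hx'⟩ := by simp [hlt.ne]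
      have hright := hrow _ h _ h' rfl (by simp [hlt.ne])
      have hleft := hrow _ h' _ h rfl (by simp [hlt.ne'])
      rw [forall_not_isPredecessor_pathGraph_iff hne] at hright
      rw [forall_not_isPredecessor_pathGraph_iff hne.symm] at hleft
      simp only at hright hleft
      omega
    · rintro x y y' ⟨hx, hy, h⟩ ⟨_, hy', h'⟩ hlt
      have hne : (⟨y, hy⟩ : Fin m) ≠ ⟨y', hy'⟩ := by simp [hlt.ne]
      have hup := hcol _ h _ h' rfl (by simp [hlt.ne])
      have hdown := hcol _ h' _ h rfl (by simp [hlt.ne'])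
      rw [forall_not_isPredecessor_pathGraph_iff hne] at hup
      rw [forall_not_isPredecessor_pathGraph_iff hne.symm] at hdown
      simp only at hup hdown
      omega
    · rintro s t a b c d ⟨_, _, hst⟩ ⟨_, _, hab⟩ ⟨_, _, hcd⟩ hac hdb
      exact hcorner _ hst _ hab _ hcd (isPredecessor_pathGraph_iff.2 hac)
        (isPredecessor_pathGraph_iff.2 hdb)
  · intro hX
    have mem {v : Fin n × Fin m} (hv : v ∈ X) : ((v.1 : ℕ), (v.2 : ℕ)) ∈ X.map (coordinates n m) :=
      Finset.mem_map_of_mem (coordinates n m) hv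
    refine ⟨fun u hu p hp h₂ hne => ?_, fun u hu p hp h₁ hne => ?_, fun u hu p hp q hq => ?_⟩
    · have h₁ : u.1 ≠ p.1 := fun h => hne (Prod.ext h h₂)
      rw [forall_not_isPredecessor_pathGraph_iff h₁]
      have hright := hX.row (mem hu) (h₂ ▸ mem hp)
      have hleft := hX.row (mem hp) (h₂ ▸ mem hu)
      omega
    · have h₂ : u.2 ≠ p.2 := fun h => hne (Prod.ext h₁ h)
      rw [forall_not_isPredecessor_pathGraph_iff h₂]
      have hup := hX.col (mem hu) (h₁ ▸ mem hp)
      have hdown := hX.col (mem hp) (h₁ ▸ mem hu)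
      omega
    · rw [isPredecessor_pathGraph_iff, isPredecessor_pathGraph_iff]
      exact hX.corner (mem hu) (mem hp) (mem hq)

theorem le_outerMutualVisibilityNumber_gridGraph_iff {k : ℕ} :
    k ≤ (gridGraph n m).outerMutualVisibilityNumber ↔
      ∃ Y, IsUnobstructed n m Y ∧ k ≤ Y.card := by
  constructor
  · obtain ⟨X, hX, hcard⟩ := exists_ncard_eq_outerMutualVisibilityNumber (gridGraph n m)
    lift X to Finset (Fin n × Fin m) using X.toFinite
    rw [Set.ncard_coe_finset] at hcard
    exact fun hk => ⟨_, isOuterMutualVisibilitySet_gridGraph_iff.1 hX, by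
      rwa [Finset.card_map, hcard]⟩
  · rintro ⟨Y, hY, hk⟩
    have hmem : Y ⊆ Finset.univ.map (coordinates n m) := fun p hp => by
      obtain ⟨hx, hy⟩ := hY.lt hp
      exact mk_mem_map_coordinates.2 ⟨hx, hy, Finset.mem_univ _⟩
    obtain ⟨X, -, rfl⟩ := Finset.subset_map_iff.1 hmem
    rw [Finset.card_map, ← Set.ncard_coe_finset] at hk
    exact hk.trans (ncard_le_outerMutualVisibilityNumber
      (isOuterMutualVisibilitySet_gridGraph_iff.2 hY))

end Grid

section Sparse

/-- A set of points of the `n × m` grid that meets lines only in their ends and has no two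
diagonally adjacent points. These are the outer mutual-visibility sets with more than `m` points. -/
structure IsSparse (n m : ℕ) (Y : Finset (ℕ × ℕ)) : Prop extends MeetsLinesInEnds n m Y where
  diag : ∀ ⦃x y z⦄, (x, y) ∈ Y → (x + 1, z) ∈ Y → z ≠ y + 1 ∧ y ≠ z + 1

variable {n m : ℕ} {Y : Finset (ℕ × ℕ)}

theorem IsSparse.isUnobstructed (hY : IsSparse n m Y) : IsUnobstructed n m Y where
  toMeetsLinesInEnds := hY.toMeetsLinesInEnds
  corner s t a b c d _ hab hcd hac hdb := by
    obtain ⟨rfl, -⟩ | ⟨rfl, -⟩ := hac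
    · have := hY.diag hab hcd
      grind [Precedes]
    · have := hY.diag hcd hab
      grind [Precedes]

-- Two consecutive rows lie on the same side of row `t`, and then one of the two ends of row `t`
-- sees the two points of a diagonal as the two predecessors of a third point.
theorem IsUnobstructed.isSparse_of_ends_mem {t : ℕ} (hY : IsUnobstructed n m Y)
    (hleft : (0, t) ∈ Y) (hright : (n - 1, t) ∈ Y) : IsSparse n m Y where
  toMeetsLinesInEnds := hY.toMeetsLinesInEnds
  diag x y z hxy hxz := by
    have hlt := hY.lt hxz
    have from_left := hY.corner hleft hxy hxz
    have from_right := hY.corner hright hxz hxy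
    rw [Precedes, Precedes] at from_left from_right
    omega

theorem IsSparse.ne_of_mem_consecutive_rows {x x' y : ℕ} (hY : IsSparse n m Y) (hx : (x, y) ∈ Y)
    (hx' : (x', y + 1) ∈ Y) : x + 1 ≠ x' ∧ x' + 1 ≠ x := by
  constructor
  · rintro rfl
    exact (hY.diag hx hx').1 rfl
  · rintro rfl
    exact (hY.diag hx' hx).2 rfl

theorem IsUnobstructed.isSparse (hY : IsUnobstructed n m Y) (hcard : m < Y.card) :
    IsSparse n m Y := by
  have hrows : ∀ p ∈ Y, p.2 ∈ Finset.range m := fun p hp => Finset.mem_range.2 (hY.lt hp).2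
  obtain ⟨⟨x, t⟩, hx, ⟨x', t'⟩, hx', hne, htt⟩ :=
    Finset.exists_ne_map_eq_of_card_lt_of_maps_to (by rwa [Finset.card_range]) hrows
  obtain rfl : t = t' := htt
  wlog hlt : x < x' generalizing x x'
  · exact this x' hx' x hx hne.symm (by grind)
  obtain ⟨rfl, hn⟩ := hY.row hx hx' hlt
  exact hY.isSparse_of_ends_mem hx (by rwa [← hn])

/-- The rows that contain a point of `Y` off the last column of the `n × m` grid. -/
def frontRows (n : ℕ) (Y : Finset (ℕ × ℕ)) : Finset ℕ :=
  (Y.filter (·.1 + 1 ≠ n)).image Prod.snd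

/-- The rows that contain a point of `Y` on the last column of the `n × m` grid. -/
def lastRows (n : ℕ) (Y : Finset (ℕ × ℕ)) : Finset ℕ :=
  (Y.filter (·.1 + 1 = n)).image Prod.snd

theorem mem_frontRows {y : ℕ} : y ∈ frontRows n Y ↔ ∃ x, (x, y) ∈ Y ∧ x + 1 ≠ n := by
  simp [frontRows]

theorem mem_lastRows {y : ℕ} : y ∈ lastRows n Y ↔ ∃ x, (x, y) ∈ Y ∧ x + 1 = n := by
  simp [lastRows]

/-- The corners of the `n × m` grid. -/
def corners (n m : ℕ) : Finset (ℕ × ℕ) :=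
  {0, n - 1} ×ˢ {0, m - 1}

theorem mk_mem_corners {x y : ℕ} :
    (x, y) ∈ corners n m ↔ (x = 0 ∨ x = n - 1) ∧ (y = 0 ∨ y = m - 1) := by
  simp [corners]

theorem card_corners (hn : 2 ≤ n) (hm : 2 ≤ m) : (corners n m).card = 4 := by
  rw [corners, Finset.card_product, Finset.card_pair (by omega), Finset.card_pair (by omega)]

namespace MeetsLinesInEnds

variable (hY : MeetsLinesInEnds n m Y)
include hY

theorem card_frontRows_add_card_lastRows : (frontRows n Y).card + (lastRows n Y).card = Y.card := by
  rw [frontRows, lastRows, Finset.card_image_of_injOn, Finset.card_image_of_injOn, add_comm,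
    Finset.card_filter_add_card_filter_not]
  · rintro ⟨x, y⟩ hx ⟨x', -⟩ hx' rfl
    grind
  · rintro ⟨x, y⟩ hx ⟨x', -⟩ hx' rfl
    have := hY.row (x := x) (x' := x') (y := y)
    have := hY.row (x := x') (x' := x) (y := y)
    grind

theorem frontRows_subset : frontRows n Y ⊆ Finset.range m := by
  intro y hy
  obtain ⟨x, hx, -⟩ := mem_frontRows.1 hy
  exact Finset.mem_range.2 (hY.lt hx).2

theorem eq_zero_and_add_one_eq_of_mem_lastRows {y y' : ℕ} (hy : y ∈ lastRows n Y)
    (hy' : y' ∈ lastRows n Y) (hlt : y < y') : y = 0 ∧ y' + 1 = m := by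
  obtain ⟨x, hx, hxn⟩ := mem_lastRows.1 hy
  obtain ⟨x', hx', hxn'⟩ := mem_lastRows.1 hy'
  obtain rfl : x = x' := by omega
  exact hY.col hx hx' hlt

theorem card_lastRows_le : (lastRows n Y).card ≤ 2 := by
  by_contra! h
  obtain ⟨a, b, c, ha, hb, hc, hab, hac, hbc⟩ := Finset.two_lt_card.1 h
  have h := @hY.eq_zero_and_add_one_eq_of_mem_lastRows
  grind

theorem right_corners_mem (hcard : (lastRows n Y).card = 2) :
    (n - 1, 0) ∈ Y ∧ (n - 1, m - 1) ∈ Y := by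
  obtain ⟨a, ha, b, hb, hab⟩ := Finset.one_lt_card.1 (hcard ▸ one_lt_two)
  wlog hlt : a < b generalizing a b
  · exact this b hb a ha hab.symm (by omega)
  obtain ⟨rfl, hbm⟩ := hY.eq_zero_and_add_one_eq_of_mem_lastRows ha hb hlt
  obtain ⟨x, hx, rfl⟩ := mem_lastRows.1 ha
  obtain ⟨x', hx', hxx⟩ := mem_lastRows.1 hb
  obtain rfl : x' = x := by omega
  exact ⟨hx, by rwa [← hbm]⟩

theorem zero_mem_of_mem_frontRows {y : ℕ} (hmem : (n - 1, y) ∈ Y) (hy : y ∈ frontRows n Y) :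
    (0, y) ∈ Y := by
  obtain ⟨x, hx, hxn⟩ := mem_frontRows.1 hy
  have := hY.lt hx
  obtain rfl := (hY.row hx hmem (by omega)).1
  exact hx

theorem corners_subset (hcard : (lastRows n Y).card = 2) (hfirst : 0 ∈ frontRows n Y)
    (hlast : m - 1 ∈ frontRows n Y) : corners n m ⊆ Y := by
  rintro ⟨x, y⟩ hxy
  obtain ⟨hright, hright'⟩ := hY.right_corners_mem hcard
  obtain ⟨rfl | rfl, rfl | rfl⟩ := mk_mem_corners.1 hxy
  · exact hY.zero_mem_of_mem_frontRows hright hfirst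
  · exact hY.zero_mem_of_mem_frontRows hright' hlast
  · exact hright
  · exact hright'

theorem card_le : Y.card ≤ m + 2 := by
  have hfront := Finset.card_le_card hY.frontRows_subset
  rw [Finset.card_range] at hfront
  have := hY.card_frontRows_add_card_lastRows
  have := hY.card_lastRows_le
  omega

theorem frontRows_eq_range_and_card_lastRows (hcard : m + 2 ≤ Y.card) :
    frontRows n Y = Finset.range m ∧ (lastRows n Y).card = 2 := by
  have hsum := hY.card_frontRows_add_card_lastRows
  have hlast := hY.card_lastRows_le
  have hfront := Finset.card_le_card hY.frontRows_subset
  rw [Finset.card_range] at hfront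
  exact ⟨Finset.eq_of_subset_of_card_le hY.frontRows_subset (by rw [Finset.card_range]; omega),
    by omega⟩

theorem frontRows_eq_erase_and_card_lastRows {r : ℕ} (hcard : m < Y.card) (hr : r < m)
    (hrY : r ∉ frontRows n Y) :
    frontRows n Y = (Finset.range m).erase r ∧ (lastRows n Y).card = 2 := by
  have hsub := Finset.subset_erase.2 ⟨hY.frontRows_subset, hrY⟩
  have herase := Finset.card_erase_of_mem (Finset.mem_range.2 hr)
  rw [Finset.card_range] at herase
  have hfront := Finset.card_le_card hsub
  have hsum := hY.card_frontRows_add_card_lastRows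
  have hlast := hY.card_lastRows_le
  exact ⟨Finset.eq_of_subset_of_card_le hsub (by omega), by omega⟩

end MeetsLinesInEnds

end Sparse

section Spread

/-- A choice of a column `f y` for each row `y ∈ S` such that the points `(f y, y)` and the four
corners of the `n × m` grid together form a sparse set. -/
structure IsSpread (n m : ℕ) (S : Finset ℕ) (f : ℕ → ℕ) : Prop where
  inner_row : ∀ ⦃y⦄, y ∈ S → 0 < y ∧ y + 1 < m
  inner_col : ∀ ⦃y⦄, y ∈ S → 0 < f y ∧ f y + 1 < n
  border : ∀ ⦃y⦄, y ∈ S → y = 1 ∨ y + 2 = m → 1 < f y ∧ f y + 2 < n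
  injOn : ∀ ⦃y z⦄, y ∈ S → z ∈ S → f y = f z → y = z
  separated : ∀ ⦃y⦄, y ∈ S → y + 1 ∈ S → f y + 1 ≠ f (y + 1) ∧ f (y + 1) + 1 ≠ f y

variable {n n' m : ℕ} {S : Finset ℕ} {f : ℕ → ℕ} {Y : Finset (ℕ × ℕ)}

theorem IsSpread.mono (hf : IsSpread n m S f) (hn : n ≤ n') : IsSpread n' m S f where
  inner_row := hf.inner_row
  inner_col y hy := by have := hf.inner_col hy; omega
  border y hy h := by have := hf.border hy h; omega
  injOn := hf.injOn
  separated := hf.separated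

/-- The corners of the `n × m` grid and the points of the graph of `f` over the rows in `S`. -/
def cornersUnionGraph (n m : ℕ) (S : Finset ℕ) (f : ℕ → ℕ) : Finset (ℕ × ℕ) :=
  corners n m ∪ S.image fun y => (f y, y)

theorem mk_mem_cornersUnionGraph {x y : ℕ} : (x, y) ∈ cornersUnionGraph n m S f ↔
    (x = 0 ∨ x = n - 1) ∧ (y = 0 ∨ y = m - 1) ∨ y ∈ S ∧ f y = x := by
  simp [cornersUnionGraph, mk_mem_corners]

theorem IsSpread.card_cornersUnionGraph (hf : IsSpread n m S f) (hn : 2 ≤ n) (hm : 2 ≤ m) :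
    (cornersUnionGraph n m S f).card = S.card + 4 := by
  rw [cornersUnionGraph, Finset.card_union_of_disjoint, card_corners hn hm,
    Finset.card_image_of_injective _ fun y z h => congrArg Prod.snd h, add_comm]
  rw [Finset.disjoint_right, Finset.forall_mem_image]
  intro y hy
  have := hf.inner_row hy
  rw [mk_mem_corners]
  omega

theorem IsSpread.isSparse (hf : IsSpread n m S f) (hn : 3 ≤ n) (hm : 2 ≤ m) :
    IsSparse n m (cornersUnionGraph n m S f) := by
  refine ⟨⟨?_, ?_, ?_⟩, ?_⟩ <;> simp only [mk_mem_cornersUnionGraph]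
  · rintro x y (hxy | ⟨hy, rfl⟩)
    · omega
    · have := hf.inner_row hy
      have := hf.inner_col hy
      omega
  · rintro x x' y (hxy | ⟨hy, rfl⟩) (hxy' | ⟨hy', rfl⟩) hlt
    · omega
    · have := hf.inner_row hy'
      omega
    · have := hf.inner_row hy
      omega
    · omega
  · rintro x y y' (hxy | ⟨hy, rfl⟩) (hxy' | ⟨hy', hyy'⟩) hlt
    · omega
    · have := hf.inner_col hy'
      omega
    · have := hf.inner_col hy
      omega
    · exact absurd (hf.injOn hy hy' hyy'.symm) hlt.ne
  · rintro x y z (hxy | ⟨hy, rfl⟩) (hxz | ⟨hz, hyz⟩)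
    · omega
    · have := hf.border hz
      have := hf.inner_row hz
      omega
    · have := hf.border hy
      have := hf.inner_row hy
      omega
    · constructor
      · rintro rfl
        exact (hf.separated hy hz).1 hyz.symm
      · rintro rfl
        exact (hf.separated hz hy).2 hyz.symm

theorem IsSparse.exists_isSpread_of_subset_frontRows (hY : IsSparse n m Y)
    (hcorners : corners n m ⊆ Y) (hinner : ∀ ⦃y⦄, y ∈ S → 0 < y ∧ y + 1 < m)
    (hS : S ⊆ frontRows n Y) : ∃ f, IsSpread n m S f := by
  have hexists : ∀ y ∈ S, ∃ x, (x, y) ∈ Y ∧ x + 1 ≠ n := fun y hy => mem_frontRows.1 (hS hy)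
  choose! f hfY hfn using hexists
  have horigin : (0, 0) ∈ Y := hcorners (mk_mem_corners.2 (by simp))
  have hcol ⦃y⦄ (hy : y ∈ S) : 0 < f y ∧ f y + 1 < n := by
    have := hinner hy
    have := hY.lt (hfY y hy)
    have := hfn y hy
    have (h : f y = 0) := hY.col horigin (h ▸ hfY y hy)
    omega
  refine ⟨f, hinner, hcol, ?_, ?_, ?_⟩
  · intro y hy hborder
    obtain ⟨z, hz, hyz⟩ : ∃ z, (z = 0 ∨ z = m - 1) ∧ (y + 1 = z ∨ z + 1 = y) := by
      obtain rfl | hborder := hborder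
      · exact ⟨0, by omega⟩
      · exact ⟨m - 1, by omega⟩
    have hdiag {x : ℕ} (hx : x = 0 ∨ x = n - 1) : x + 1 ≠ f y ∧ f y + 1 ≠ x := by
      have hmem := hcorners (mk_mem_corners.2 ⟨hx, hz⟩)
      obtain rfl | rfl := hyz
      · exact (hY.ne_of_mem_consecutive_rows (hfY y hy) hmem).symm
      · exact hY.ne_of_mem_consecutive_rows hmem (hfY _ hy)
    have := hcol hy
    have := @hdiag 0
    have := @hdiag (n - 1)
    omega
  · intro y z hy hz hyz
    have := hinner hy
    have := hinner hz
    obtain hlt | rfl | hlt := lt_trichotomy y z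
    · have := hY.col (hfY y hy) (hyz ▸ hfY z hz) hlt
      omega
    · rfl
    · have := hY.col (hyz ▸ hfY z hz) (hfY y hy) hlt
      omega
  · exact fun y hy hy' => hY.ne_of_mem_consecutive_rows (hfY y hy) (hfY _ hy')

theorem IsSparse.exists_isSpread (hY : IsSparse n m Y) (hm : 0 < m) (hcard : m + 2 ≤ Y.card) :
    ∃ f, IsSpread n m (Finset.Ioo 0 (m - 1)) f := by
  obtain ⟨hfront, hlast⟩ := hY.frontRows_eq_range_and_card_lastRows hcard
  have hmem {y : ℕ} (hy : y < m) : y ∈ frontRows n Y := hfront ▸ Finset.mem_range.2 hy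
  have hinner ⦃y : ℕ⦄ (hy : y ∈ Finset.Ioo 0 (m - 1)) : 0 < y ∧ y + 1 < m := by
    rw [Finset.mem_Ioo] at hy
    omega
  exact hY.exists_isSpread_of_subset_frontRows (hY.corners_subset hlast (hmem hm) (hmem (by omega)))
    hinner fun y hy => hmem (by have := hinner hy; omega)

-- The first half of the rows runs through the even columns, the second half through the odd ones;
-- for odd `m` the second run is `1, m - 2, 3, 5, …`, which keeps it apart from the first.
theorem exists_isSpread_of_six_le (hm : 6 ≤ m) :
    ∃ f, IsSpread m m (Finset.Ioo 0 (m - 1)) f := by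
  obtain ⟨j, rfl | rfl⟩ := m.even_or_odd'
  · refine ⟨fun y => if y < j then 2 * y else 2 * y - 2 * j + 1, ?_⟩
    constructor <;> simp only [Finset.mem_Ioo] <;> grind
  · refine ⟨fun y => if y < j then 2 * y else if y = j then 1 else
      if y = j + 1 then 2 * j - 1 else 2 * y - 2 * j - 1, ?_⟩
    constructor <;> simp only [Finset.mem_Ioo] <;> grind

theorem exists_isSpread (hmn : m ≤ n)
    (h : m = 2 ∨ m = 3 ∧ 5 ≤ n ∨ m = 4 ∧ 7 ≤ n ∨ m = 5 ∧ 7 ≤ n ∨ 6 ≤ m) :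
    ∃ f, IsSpread n m (Finset.Ioo 0 (m - 1)) f := by
  obtain rfl | ⟨rfl, hn⟩ | ⟨rfl, hn⟩ | ⟨rfl, hn⟩ | h := h
  · exact ⟨0, by constructor <;> grind⟩
  · exact ⟨fun _ => 2, by constructor <;> grind⟩
  · exact ⟨fun y => 2 * y, by constructor <;> grind⟩
  · exact ⟨fun y => if y = 1 then 2 else if y = 2 then 5 else 3, by constructor <;> grind⟩
  · obtain ⟨f, hf⟩ := exists_isSpread_of_six_le h
    exact ⟨f, hf.mono hmn⟩

theorem not_isSpread (h : m = 3 ∧ n ≤ 4 ∨ m = 4 ∧ n ≤ 6 ∨ m = 5 ∧ n ≤ 6) :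
    ¬ IsSpread n m (Finset.Ioo 0 (m - 1)) f := by
  intro hf
  obtain ⟨rfl, hn⟩ | ⟨rfl, hn⟩ | ⟨rfl, hn⟩ := h
  · have := hf.border (y := 1) (by simp) (by simp)
    omega
  · have := hf.border (y := 1) (by simp) (by simp)
    have := hf.border (y := 2) (by simp) (by simp)
    have := hf.injOn (y := 1) (z := 2) (by simp) (by simp)
    have : f 1 + 1 ≠ f 2 ∧ f 2 + 1 ≠ f 1 := hf.separated (by simp) (by simp)
    omega
  · have := hf.border (y := 1) (by simp) (by simp)
    have := hf.inner_col (y := 2) (by simp)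
    have := hf.border (y := 3) (by simp) (by simp)
    have := hf.injOn (y := 1) (z := 2) (by simp) (by simp)
    have := hf.injOn (y := 1) (z := 3) (by simp) (by simp)
    have := hf.injOn (y := 2) (z := 3) (by simp) (by simp)
    have : f 1 + 1 ≠ f 2 ∧ f 2 + 1 ≠ f 1 := hf.separated (by simp) (by simp)
    have : f 2 + 1 ≠ f 3 ∧ f 3 + 1 ≠ f 2 := hf.separated (by simp) (by simp)
    omega

end Spread

section Square

variable {m : ℕ} {f : ℕ → ℕ} {Y : Finset (ℕ × ℕ)}

theorem IsSparse.card_le_two (hY : IsSparse 2 2 Y) : Y.card ≤ 2 := by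
  rw [← Finset.card_range 2]
  refine Finset.card_le_card_of_injOn (fun p => (p.1 + p.2) % 2) (fun p _ => ?_) ?_
  · exact Finset.mem_coe.2 (Finset.mem_range.2 (Nat.mod_lt _ two_pos))
  · rintro ⟨x, y⟩ hxy ⟨x', y'⟩ hxy' heq
    have := hY.lt hxy
    have := hY.lt hxy'
    have (h : x + 1 = x') := hY.diag hxy (h ▸ hxy')
    have (h : x' + 1 = x) := hY.diag hxy' (h ▸ hxy)
    grind

theorem IsSparse.exists_notMem_frontRows (hY : IsSparse m m Y) (hm : m = 4 ∨ m = 5) :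
    ∃ y < m, y ∉ frontRows m Y := by
  by_contra! hfront
  simp only [mem_frontRows] at hfront
  choose! f hfY hfm using hfront
  have hlt {y : ℕ} (hy : y < m) : f y + 1 < m := by
    have := hY.lt (hfY y hy)
    have := hfm y hy
    omega
  have hcol {y z : ℕ} (hz : z < m) (hyz : y < z) (h : f y = f z) : y = 0 ∧ z + 1 = m :=
    hY.col (hfY y (by omega)) (h ▸ hfY z hz) hyz
  have hsep {y z : ℕ} (hz : z < m) (hyz : y + 1 = z) : f y + 1 ≠ f z ∧ f z + 1 ≠ f y :=
    hY.ne_of_mem_consecutive_rows (hfY y (by omega)) (hyz ▸ hfY z hz)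
  obtain rfl | rfl := hm
  · have := @hlt 0; have := @hlt 1; have := @hlt 2
    have := @hcol 0 1; have := @hcol 0 2; have := @hcol 1 2
    have := @hsep 0 1; have := @hsep 1 2
    omega
  · have := @hlt 0; have := @hlt 1; have := @hlt 2; have := @hlt 3; have := @hlt 4
    have := @hcol 0 1; have := @hcol 0 2; have := @hcol 0 3; have := @hcol 1 2; have := @hcol 1 3
    have := @hcol 1 4; have := @hcol 2 3; have := @hcol 2 4; have := @hcol 3 4
    have := @hsep 0 1; have := @hsep 1 2; have := @hsep 2 3; have := @hsep 3 4
    omega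

theorem IsSparse.exists_inner_notMem_frontRows (hY : IsSparse m m Y)
    (hcorner : (0, 0) ∈ Y ∨ (0, m - 1) ∈ Y) (hm : m = 4 ∨ m = 5) :
    ∃ y, 0 < y ∧ y + 1 < m ∧ y ∉ frontRows m Y := by
  by_contra! hfront
  simp only [mem_frontRows] at hfront
  choose! f hf using hfront
  have hcol {y : ℕ} (hy : 0 < y ∧ y + 1 < m) : 0 < f y ∧ f y + 1 < m := by
    obtain ⟨hmem, hne⟩ := hf y hy.1 hy.2
    have := hY.lt hmem
    have hzero : f y ≠ 0 := fun h => by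
      rw [h] at hmem
      obtain hfirst | hlast := hcorner
      · exact hy.2.ne (hY.col hfirst hmem hy.1).2
      · exact hy.1.ne' (hY.col hmem hlast (by omega)).1
    omega
  have hinj {y z : ℕ} (hy : 0 < y) (hyz : y < z) (hz : z + 1 < m) : f y ≠ f z := fun h => by
    have := hY.col (hf y hy (by omega)).1 (h ▸ (hf z (by omega) hz).1)
    omega
  have hsep {y z : ℕ} (hy : 0 < y) (hyz : y + 1 = z) (hz : z + 1 < m) :
      f y + 1 ≠ f z ∧ f z + 1 ≠ f y :=
    hY.ne_of_mem_consecutive_rows (hf y hy (by omega)).1 (hyz ▸ (hf z (by omega) hz).1)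
  obtain rfl | rfl := hm
  · have := @hcol 1; have := @hcol 2; have := @hinj 1 2; have := @hsep 1 2
    omega
  · have := @hcol 1; have := @hcol 2; have := @hcol 3
    have := @hinj 1 2; have := @hinj 1 3; have := @hinj 2 3
    have := @hsep 1 2; have := @hsep 2 3
    omega

theorem not_isSpread_erase {r : ℕ} (hm : m = 4 ∨ m = 5) :
    ¬ IsSpread m m ((Finset.Ioo 0 (m - 1)).erase r) f := by
  intro hf
  have hmem {y : ℕ} (hy : 0 < y ∧ y < m - 1) (hr : y ≠ r) : y ∈ (Finset.Ioo 0 (m - 1)).erase r :=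
    Finset.mem_erase.2 ⟨hr, Finset.mem_Ioo.2 hy⟩
  obtain rfl | rfl := hm
  · have (hr : 1 ≠ r) := hf.border (hmem (by simp) hr) (by simp)
    have (hr : 2 ≠ r) := hf.border (hmem (by simp) hr) (by simp)
    omega
  · have hrow₁ (hr : 1 ≠ r) := hf.border (hmem (by simp) hr) (by simp)
    have hrow₂ (hr : 2 ≠ r) := hf.inner_col (hmem (by simp) hr)
    have hrow₃ (hr : 3 ≠ r) := hf.border (hmem (by simp) hr) (by simp)
    obtain ⟨h₁, h₂⟩ | ⟨h₁, h₃⟩ | ⟨h₂, h₃⟩ :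
      (1 ≠ r ∧ 2 ≠ r) ∨ (1 ≠ r ∧ 3 ≠ r) ∨ (2 ≠ r ∧ 3 ≠ r) := by omega
    · have : f 1 + 1 ≠ f 2 ∧ f 2 + 1 ≠ f 1 :=
        hf.separated (hmem (by simp) h₁) (hmem (by simp) h₂)
      have := hf.injOn (hmem (by simp) h₁) (hmem (by simp) h₂)
      grind
    · have := hf.injOn (hmem (by simp) h₁) (hmem (by simp) h₃)
      grind
    · have : f 2 + 1 ≠ f 3 ∧ f 3 + 1 ≠ f 2 :=
        hf.separated (hmem (by simp) h₂) (hmem (by simp) h₃)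
      have := hf.injOn (hmem (by simp) h₂) (hmem (by simp) h₃)
      grind

theorem IsUnobstructed.card_le_of_square (hY : IsUnobstructed m m Y)
    (hm : m = 2 ∨ m = 4 ∨ m = 5) : Y.card ≤ m := by
  by_contra! hcard
  have hsparse := hY.isSparse hcard
  obtain rfl | hm := hm
  · exact hsparse.card_le_two.not_gt hcard
  obtain ⟨r, hr, hrY⟩ := hsparse.exists_notMem_frontRows hm
  obtain ⟨hfront, hlast⟩ := hY.frontRows_eq_erase_and_card_lastRows hcard hr hrY
  obtain ⟨hright, hright'⟩ := hY.right_corners_mem hlast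
  have hmem {y : ℕ} (hy : y < m) (hyr : y ≠ r) : y ∈ frontRows m Y :=
    hfront ▸ Finset.mem_erase.2 ⟨hyr, Finset.mem_range.2 hy⟩
  have hleft : (0, 0) ∈ Y ∨ (0, m - 1) ∈ Y := by
    obtain h | h : 0 ≠ r ∨ m - 1 ≠ r := by omega
    · exact .inl (hY.zero_mem_of_mem_frontRows hright (hmem (by omega) h))
    · exact .inr (hY.zero_mem_of_mem_frontRows hright' (hmem (by omega) h))
  obtain ⟨t, ht, htm, htY⟩ := hsparse.exists_inner_notMem_frontRows hleft hm
  obtain rfl : t = r := by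
    by_contra hne
    exact htY (hmem (by omega) hne)
  have hinner ⦃y : ℕ⦄ (hy : y ∈ (Finset.Ioo 0 (m - 1)).erase t) : 0 < y ∧ y + 1 < m ∧ y ≠ t := by
    rw [Finset.mem_erase, Finset.mem_Ioo] at hy
    omega
  have hcorners := hY.corners_subset hlast (hmem (by omega) (by omega)) (hmem (by omega) (by omega))
  obtain ⟨f, hf⟩ := hsparse.exists_isSpread_of_subset_frontRows hcorners
    (fun y hy => ⟨(hinner hy).1, (hinner hy).2.1⟩)
    fun y hy => hmem (by have := hinner hy; omega) (hinner hy).2.2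
  exact not_isSpread_erase hm hf

end Square

section Values

variable {n m : ℕ}

theorem IsSpread.card_add_four_le {S : Finset ℕ} {f : ℕ → ℕ} (hf : IsSpread n m S f)
    (hn : 3 ≤ n) (hm : 2 ≤ m) : S.card + 4 ≤ (gridGraph n m).outerMutualVisibilityNumber := by
  have : NeZero n := ⟨by omega⟩
  have : NeZero m := ⟨by omega⟩
  exact le_outerMutualVisibilityNumber_gridGraph_iff.2
    ⟨_, (hf.isSparse hn hm).isUnobstructed, (hf.card_cornersUnionGraph (by omega) hm).ge⟩

theorem outerMutualVisibilityNumber_gridGraph_le [NeZero n] [NeZero m] :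
    (gridGraph n m).outerMutualVisibilityNumber ≤ m + 2 := by
  obtain ⟨Y, hY, hcard⟩ := le_outerMutualVisibilityNumber_gridGraph_iff.1
    (le_refl (gridGraph n m).outerMutualVisibilityNumber)
  exact hcard.trans hY.card_le

theorem add_two_le_outerMutualVisibilityNumber_gridGraph_iff (hn : 3 ≤ n) (hm : 2 ≤ m) :
    m + 2 ≤ (gridGraph n m).outerMutualVisibilityNumber ↔
      ∃ f, IsSpread n m (Finset.Ioo 0 (m - 1)) f := by
  have : NeZero n := ⟨by omega⟩
  have : NeZero m := ⟨by omega⟩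
  constructor
  · intro h
    obtain ⟨Y, hY, hcard⟩ := le_outerMutualVisibilityNumber_gridGraph_iff.1 h
    exact (hY.isSparse (by omega)).exists_isSpread (by omega) hcard
  · rintro ⟨f, hf⟩
    have := hf.card_add_four_le hn hm
    rw [Nat.card_Ioo] at this
    omega

theorem outerMutualVisibilityNumber_gridGraph_square_le (hm : m = 2 ∨ m = 4 ∨ m = 5) :
    (gridGraph m m).outerMutualVisibilityNumber ≤ m := by
  have : NeZero m := ⟨by omega⟩
  obtain ⟨Y, hY, hcard⟩ := le_outerMutualVisibilityNumber_gridGraph_iff.1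
    (le_refl (gridGraph m m).outerMutualVisibilityNumber)
  exact hcard.trans (hY.card_le_of_square hm)

theorem outerMutualVisibilityNumber_gridGraph_eq_add_two (hn : 3 ≤ n) (hmn : m ≤ n)
    (h : m = 2 ∨ m = 3 ∧ 5 ≤ n ∨ m = 4 ∧ 7 ≤ n ∨ m = 5 ∧ 7 ≤ n ∨ 6 ≤ m) :
    (gridGraph n m).outerMutualVisibilityNumber = m + 2 := by
  have : NeZero n := ⟨by omega⟩
  have : NeZero m := ⟨by omega⟩
  exact outerMutualVisibilityNumber_gridGraph_le.antisymm
    ((add_two_le_outerMutualVisibilityNumber_gridGraph_iff hn (by omega)).2 (exists_isSpread hmn h))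

theorem outerMutualVisibilityNumber_gridGraph_eq_add_one
    (h : m = 3 ∧ (n = 3 ∨ n = 4) ∨ m = 4 ∧ (n = 5 ∨ n = 6) ∨ m = 5 ∧ n = 6) :
    (gridGraph n m).outerMutualVisibilityNumber = m + 1 := by
  have hupper : ¬ m + 2 ≤ (gridGraph n m).outerMutualVisibilityNumber := by
    rw [add_two_le_outerMutualVisibilityNumber_gridGraph_iff (by omega) (by omega), not_exists]
    exact fun f => not_isSpread (by omega)
  suffices h : ∃ S f, IsSpread n m S f ∧ S.card + 4 = m + 1 by
    obtain ⟨S, f, hf, hS⟩ := h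
    have := hf.card_add_four_le (by omega) (by omega)
    omega
  obtain ⟨rfl, -⟩ | ⟨rfl, hn⟩ | ⟨rfl, rfl⟩ := h
  · exact ⟨∅, 0, by constructor <;> simp, rfl⟩
  · exact ⟨{1}, fun _ => 2, by constructor <;> grind, rfl⟩
  · exact ⟨{1, 3}, fun y => (y + 3) / 2, by constructor <;> grind, rfl⟩

theorem outerMutualVisibilityNumber_gridGraph_square (hm : m = 2 ∨ m = 4 ∨ m = 5) :
    (gridGraph m m).outerMutualVisibilityNumber = m := by
  apply (outerMutualVisibilityNumber_gridGraph_square_le hm).antisymm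
  obtain rfl | rfl | rfl := hm
  · refine le_outerMutualVisibilityNumber_gridGraph_iff.2 ⟨{(0, 0), (1, 0)}, ?_, le_rfl⟩
    exact IsSparse.isUnobstructed ⟨by constructor <;> grind, by grind⟩
  · have hf : IsSpread 4 4 ∅ 0 := by constructor <;> simp
    exact hf.card_add_four_le (by omega) (by omega)
  · have hf : IsSpread 5 5 {2} fun _ => 2 := by constructor <;> grind
    exact hf.card_add_four_le (by omega) (by omega)

end Values

end OuterMutualVisibility

open OuterMutualVisibility

theorem mainTheorem2 (n m : ℕ) (hm : 2 ≤ m) (hmn : m ≤ n) :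
    (SimpleGraph.gridGraph n m).outerMutualVisibilityNumber =
      if (n, m) = (2, 2) then 2
      else if (n, m) ∈ ({(3, 2), (3, 3), (4, 3), (4, 4)} : Finset (ℕ × ℕ)) then 4
      else if (n, m) ∈ ({(5, 4), (5, 5), (6, 4)} : Finset (ℕ × ℕ)) then 5
      else if (n, m) = (6, 5) then 6
      else m + 2 := by
  simp only [Finset.mem_insert, Finset.mem_singleton, Prod.mk.injEq]
  split_ifs with h₂ h₄ h₅ h₆
  · obtain ⟨rfl, rfl⟩ := h₂
    exact outerMutualVisibilityNumber_gridGraph_square (by omega)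
  · obtain ⟨rfl, rfl⟩ | ⟨rfl, rfl⟩ | ⟨rfl, rfl⟩ | ⟨rfl, rfl⟩ := h₄
    · exact outerMutualVisibilityNumber_gridGraph_eq_add_two (by omega) (by omega) (by omega)
    · exact outerMutualVisibilityNumber_gridGraph_eq_add_one (by omega)
    · exact outerMutualVisibilityNumber_gridGraph_eq_add_one (by omega)
    · exact outerMutualVisibilityNumber_gridGraph_square (by omega)
  · obtain ⟨rfl, rfl⟩ | ⟨rfl, rfl⟩ | ⟨rfl, rfl⟩ := h₅
    · exact outerMutualVisibilityNumber_gridGraph_eq_add_one (by omega)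
    · exact outerMutualVisibilityNumber_gridGraph_square (by omega)
    · exact outerMutualVisibilityNumber_gridGraph_eq_add_one (by omega)
  · obtain ⟨rfl, rfl⟩ := h₆
    exact outerMutualVisibilityNumber_gridGraph_eq_add_one (by omega)
  · exact outerMutualVisibilityNumber_gridGraph_eq_add_two (by omega) hmn (by omega)
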